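/- **Definitions.** A smooth function $g:\mathbb{R}\to\mathbb{R}$ is *analytic at infinity* if there are $\epsilon_1,\epsilon_2>0$ and real sequences $(a_n)_{n\ge1},(b_n)_{n\ge1}$ such that $g(1/x)=\sum_{n\ge1}a_nx^n$ for $0<x<\epsilon_1$ and $g(1/x)=\sum_{n\ge1}b_nx^n$ for $-\epsilon_2<x<0$, both series converging absolutely there. A function $g$ on $\mathbb{R}^d$ ($d=2,3$) is of *decrease $n$* if there is a constant $c>0$ with $|g(v)|\le c/|v|^n$ for all $v$ with $|v|>1$, where $|v|$ is the Euclidean norm. A smooth function $g:\mathbb{R}^2\to\mathbb{R}$ is *normal* if (i) for every $x$, $y\mapsto g(x,y)$ is analytic at infinity; (ii) for every $y$, $x\mapsto g(x,y)$ is analytic at infinity; (iii) $g$ is of decrease $1$; (iv) $\partial g/\partial x$ and $\partial g/\partial y$ are of decrease $2$; (v) there is a number $N$ such that for every $x$ the function $y\mapsto g(x,y)$ and its first two derivatives each have at most $N$ zeros, and for every $y$ the same holds for $x\mapsto g(x,y)$. A smooth function $f:\mathbb{R}^3\to\mathbb{R}$ is *normal* if (i)–(iii) each function on $\mathbb{R}^2$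 obtained from $f$ by fixing one of the three variables at any real value is normal; (iv) $f$ is of decrease $1$; (v) for all $i,j,k\ge0$ with $i+j+k\ge1$, $\partial^{i+j+k}f/\partial x^i\partial y^j\partial z^k$ is of decrease $i+j+k+1$; (vi) there is a number $N$ such that every function on $\mathbb{R}$ obtained from $f$ by fixing two of the three variables at any real values, and each of its first four derivatives, has at most $N$ zeros. **Lemma.** Let $f:\mathbb{R}^3\to\mathbb{R}$ be normal and let $k_1,k_2,k_3$ be nonzero real numbers. Then, for all real $x,y,z$, the limits $$A(k_1,y,z)=\lim_{r\to\infty}\int_{-r}^{r}f(x,y,z)e^{-ik_1x}\,dx,\quad B(x,k_2,z)=\lim_{r\to\infty}\int_{-r}^{r}f(x,y,z)e^{-ik_2y}\,dy,\quad C(x,y,k_3)=\lim_{r\to\infty}\int_{-r}^{r}f(x,y,z)e^{-ik_3z}\,dz,$$ $$F(k_1,k_2,z)=\lim_{r,s\to\infty}\int_{-s}^{s}\int_{-r}^{r}f(x,y,z)e^{-ik_1x}e^{-ik_2y}\,dx\,dy,$$ $$G(k_1,y,k_3)=\lim_{r,s\to\infty}\int_{-s}^{s}\int_{-r}^{r}f(x,y,z)e^{-ik_1x}e^{-ik_3z}\,dx\,dz,$$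 $$H(x,k_2,k_3)=\lim_{r,s\to\infty}\int_{-s}^{s}\int_{-r}^{r}f(x,y,z)e^{-ik_2y}e^{-ik_3z}\,dy\,dz$$ exist (where $r,s\to\infty$ independently), and the integrals $$A(k_1,k_2,k_3)=\int_{-\infty}^{\infty}\int_{-\infty}^{\infty}A(k_1,y,z)e^{-ik_2y}e^{-ik_3z}\,dy\,dz,$$ $$B(k_1,k_2,k_3)=\int_{-\infty}^{\infty}\int_{-\infty}^{\infty}B(x,k_2,z)e^{-ik_1x}e^{-ik_3z}\,dx\,dz,$$ $$C(k_1,k_2,k_3)=\int_{-\infty}^{\infty}\int_{-\infty}^{\infty}C(x,y,k_3)e^{-ik_1x}e^{-ik_2y}\,dx\,dy,$$ $$F(k_1,k_2,k_3)=\int_{-\infty}^{\infty}F(k_1,k_2,z)e^{-ik_3z}\,dz,\quad G(k_1,k_2,k_3)=\int_{-\infty}^{\infty}G(k_1,y,k_3)e^{-ik_2y}\,dy,\quad H(k_1,k_2,k_3)=\int_{-\infty}^{\infty}H(x,k_2,k_3)e^{-ik_1x}\,dx$$ converge absolutely (the double integrals both jointly over $\mathbb{R}^2$ and, in the inner variable,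 for every value of the outer variable). Moreover, all six are equal, and their common value is $$\lim_{r,s,t\to\infty}\int_{-t}^{t}\int_{-s}^{s}\int_{-r}^{r}f(x,y,z)e^{-ik_1x}e^{-ik_2y}e^{-ik_3z}\,dx\,dy\,dz,$$ where $r,s,t\to\infty$ independently. -/

import Mathlib

open Filter Topology MeasureTheory
open scoped ContDiff

namespace NormalFourier

noncomputable section

/-- A smooth function `g` on the line is analytic at infinity: `g (1/x)` is, for small `x > 0`, an
absolutely convergent power series without constant term, and likewise (with possibly different
coefficients) for small `x < 0`. The coefficient of `x ^ (n + 1)` is `a n`, resp. `b n`. -/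
structure AnalyticAtInfinity (g : ℝ → ℝ) : Prop where
  smooth : ContDiff ℝ ∞ g
  right : ∃ ε > 0, ∃ a : ℕ → ℝ, ∀ x : ℝ, 0 < x → x < ε →
    Summable (fun n : ℕ => |a n * x ^ (n + 1)|) ∧ g (1 / x) = ∑' n : ℕ, a n * x ^ (n + 1)
  left : ∃ ε > 0, ∃ b : ℕ → ℝ, ∀ x : ℝ, -ε < x → x < 0 →
    Summable (fun n : ℕ => |b n * x ^ (n + 1)|) ∧ g (1 / x) = ∑' n : ℕ, b n * x ^ (n + 1)

/-- `|g(x,y)| ≤ C / |(x,y)|ⁿ` for `|(x,y)| > 1`, with the Euclidean norm. For `n = 1` this is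
"very moderate decrease", for `n = 2` "moderate decrease", and for `n ≥ 2` in general
"moderate decrease `n`". -/
def Decrease₂ (n : ℕ) (g : ℝ → ℝ → ℝ) : Prop :=
  ∃ C > 0, ∀ x y : ℝ, 1 < √(x ^ 2 + y ^ 2) → |g x y| ≤ C / √(x ^ 2 + y ^ 2) ^ n

/-- `|g(x,y,z)| ≤ C / |(x,y,z)|ⁿ` for `|(x,y,z)| > 1`, with the Euclidean norm. For `n = 1` this is
"very moderate decrease", for `n = 2` "moderate decrease", and for `n ≥ 2` in general
"moderate decrease `n`". -/
def Decrease₃ (n : ℕ) (g : ℝ → ℝ → ℝ → ℝ) : Prop :=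
  ∃ C > 0, ∀ x y z : ℝ, 1 < √(x ^ 2 + y ^ 2 + z ^ 2) →
    |g x y z| ≤ C / √(x ^ 2 + y ^ 2 + z ^ 2) ^ n

/-- Each of `g, g', …, g⁽ᵐ⁾` has at most `val` zeros on the line. -/
def ZerosBounded (m val : ℕ) (g : ℝ → ℝ) : Prop :=
  ∀ j ≤ m, {t : ℝ | iteratedDeriv j g t = 0}.encard ≤ val

/-- Normal functions on the whole plane. -/
structure Normal₂ (g : ℝ → ℝ → ℝ) : Prop where
  smooth : ContDiff ℝ ∞ (fun p : ℝ × ℝ => g p.1 p.2)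
  fibre_fst : ∀ x, AnalyticAtInfinity (fun y => g x y)
  fibre_snd : ∀ y, AnalyticAtInfinity (fun x => g x y)
  decrease : Decrease₂ 1 g
  decrease_deriv_fst : Decrease₂ 2 (fun x y => deriv (fun x' => g x' y) x)
  decrease_deriv_snd : Decrease₂ 2 (fun x y => deriv (fun y' => g x y') y)
  zeros : ∃ val : ℕ, (∀ x, ZerosBounded 2 val (fun y => g x y)) ∧
    (∀ y, ZerosBounded 2 val (fun x => g x y))

/-- The partial derivative `∂^(i+j+k) f / ∂x^i ∂y^j ∂z^k`. -/
def partialDeriv (i j k : ℕ) (f : ℝ → ℝ → ℝ → ℝ) (x y z : ℝ) : ℝ :=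
  iteratedDeriv i (fun x' => iteratedDeriv j (fun y' => iteratedDeriv k (fun z' =>
    f x' y' z') z) y) x

/-- Normal functions on the whole space. -/
structure Normal₃ (f : ℝ → ℝ → ℝ → ℝ) : Prop where
  smooth : ContDiff ℝ ∞ (fun p : ℝ × ℝ × ℝ => f p.1 p.2.1 p.2.2)
  fibre_x : ∀ x, Normal₂ (fun y z => f x y z)
  fibre_y : ∀ y, Normal₂ (fun x z => f x y z)
  fibre_z : ∀ z, Normal₂ (fun x y => f x y z)
  decrease : Decrease₃ 1 f
  decrease_deriv : ∀ i j k : ℕ, 1 ≤ i + j + k →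
    Decrease₃ (i + j + k + 1) (partialDeriv i j k f)
  zeros : ∃ val : ℕ, (∀ x y, ZerosBounded 4 val (fun z => f x y z)) ∧
    (∀ x z, ZerosBounded 4 val (fun y => f x y z)) ∧
    (∀ y z, ZerosBounded 4 val (fun x => f x y z))

/-- The Fourier kernel `e^{-ikx}`. -/
def e (k x : ℝ) : ℂ := Complex.exp (-(Complex.I * k * x))

/-! Truncated transforms in one, two and three variables. -/

def truncA (f : ℝ → ℝ → ℝ → ℝ) (k₁ y z r : ℝ) : ℂ :=
  ∫ x in -r..r, (f x y z : ℂ) * e k₁ x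

def truncB (f : ℝ → ℝ → ℝ → ℝ) (x k₂ z r : ℝ) : ℂ :=
  ∫ y in -r..r, (f x y z : ℂ) * e k₂ y

def truncC (f : ℝ → ℝ → ℝ → ℝ) (x y k₃ r : ℝ) : ℂ :=
  ∫ z in -r..r, (f x y z : ℂ) * e k₃ z

def truncF (f : ℝ → ℝ → ℝ → ℝ) (k₁ k₂ z : ℝ) (p : ℝ × ℝ) : ℂ :=
  ∫ y in -p.2..p.2, ∫ x in -p.1..p.1, (f x y z : ℂ) * e k₁ x * e k₂ y

def truncG (f : ℝ → ℝ → ℝ → ℝ) (k₁ y k₃ : ℝ) (p : ℝ × ℝ) : ℂ :=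
  ∫ z in -p.2..p.2, ∫ x in -p.1..p.1, (f x y z : ℂ) * e k₁ x * e k₃ z

def truncH (f : ℝ → ℝ → ℝ → ℝ) (x k₂ k₃ : ℝ) (p : ℝ × ℝ) : ℂ :=
  ∫ z in -p.2..p.2, ∫ y in -p.1..p.1, (f x y z : ℂ) * e k₂ y * e k₃ z

/-- The integral over the box `[-r,r] × [-s,s] × [-t,t]`, where `p = (r, s, t)`. -/
def truncBox (f : ℝ → ℝ → ℝ → ℝ) (k₁ k₂ k₃ : ℝ) (p : ℝ × ℝ × ℝ) : ℂ :=
  ∫ z in -p.2.2..p.2.2, ∫ y in -p.2.1..p.2.1, ∫ x in -p.1..p.1,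
    (f x y z : ℂ) * e k₁ x * e k₂ y * e k₃ z

/-! The partial transforms, as limits of the truncated ones. The limit in two parameters is the
joint one: `atTop` on `ℝ × ℝ` means that both parameters tend to infinity independently. -/

def A (f : ℝ → ℝ → ℝ → ℝ) (k₁ y z : ℝ) : ℂ := limUnder atTop (truncA f k₁ y z)

def B (f : ℝ → ℝ → ℝ → ℝ) (x k₂ z : ℝ) : ℂ := limUnder atTop (truncB f x k₂ z)

def C (f : ℝ → ℝ → ℝ → ℝ) (x y k₃ : ℝ) : ℂ := limUnder atTop (truncC f x y k₃)

def F (f : ℝ → ℝ → ℝ → ℝ) (k₁ k₂ z : ℝ) : ℂ := limUnder atTop (truncF f k₁ k₂ z)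

def G (f : ℝ → ℝ → ℝ → ℝ) (k₁ y k₃ : ℝ) : ℂ := limUnder atTop (truncG f k₁ y k₃)

def H (f : ℝ → ℝ → ℝ → ℝ) (x k₂ k₃ : ℝ) : ℂ := limUnder atTop (truncH f x k₂ k₃)

/-! The six full transforms, obtained by integrating out the remaining variables. -/

def hatA (f : ℝ → ℝ → ℝ → ℝ) (k₁ k₂ k₃ : ℝ) : ℂ := ∫ z, ∫ y, A f k₁ y z * e k₂ y * e k₃ z

def hatB (f : ℝ → ℝ → ℝ → ℝ) (k₁ k₂ k₃ : ℝ) : ℂ := ∫ z, ∫ x, B f x k₂ z * e k₁ x * e k₃ z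

def hatC (f : ℝ → ℝ → ℝ → ℝ) (k₁ k₂ k₃ : ℝ) : ℂ := ∫ y, ∫ x, C f x y k₃ * e k₁ x * e k₂ y

def hatF (f : ℝ → ℝ → ℝ → ℝ) (k₁ k₂ k₃ : ℝ) : ℂ := ∫ z, F f k₁ k₂ z * e k₃ z

def hatG (f : ℝ → ℝ → ℝ → ℝ) (k₁ k₂ k₃ : ℝ) : ℂ := ∫ y, G f k₁ y k₃ * e k₂ y

def hatH (f : ℝ → ℝ → ℝ → ℝ) (k₁ k₂ k₃ : ℝ) : ℂ := ∫ x, H f x k₂ k₃ * e k₁ x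

/-- All six partial transforms exist as limits, for all values of the free variables. -/
structure PartialTransformsExist (f : ℝ → ℝ → ℝ → ℝ) (k₁ k₂ k₃ : ℝ) : Prop where
  exists_A : ∀ y z, Tendsto (truncA f k₁ y z) atTop (𝓝 (A f k₁ y z))
  exists_B : ∀ x z, Tendsto (truncB f x k₂ z) atTop (𝓝 (B f x k₂ z))
  exists_C : ∀ x y, Tendsto (truncC f x y k₃) atTop (𝓝 (C f x y k₃))
  exists_F : ∀ z, Tendsto (truncF f k₁ k₂ z) atTop (𝓝 (F f k₁ k₂ z))
  exists_G : ∀ y, Tendsto (truncG f k₁ y k₃) atTop (𝓝 (G f k₁ y k₃))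
  exists_H : ∀ x, Tendsto (truncH f x k₂ k₃) atTop (𝓝 (H f x k₂ k₃))

/-- All integrals in the six full transforms converge absolutely: the double ones jointly (over the
plane) and also in the inner variable for every value of the outer one. -/
structure FullTransformsDefined (f : ℝ → ℝ → ℝ → ℝ) (k₁ k₂ k₃ : ℝ) : Prop where
  integrable_A : Integrable (fun p : ℝ × ℝ => A f k₁ p.1 p.2 * e k₂ p.1 * e k₃ p.2)
  integrable_A_inner : ∀ z, Integrable (fun y => A f k₁ y z * e k₂ y * e k₃ z)
  integrable_B : Integrable (fun p : ℝ × ℝ => B f p.1 k₂ p.2 * e k₁ p.1 * e k₃ p.2)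
  integrable_B_inner : ∀ z, Integrable (fun x => B f x k₂ z * e k₁ x * e k₃ z)
  integrable_C : Integrable (fun p : ℝ × ℝ => C f p.1 p.2 k₃ * e k₁ p.1 * e k₂ p.2)
  integrable_C_inner : ∀ y, Integrable (fun x => C f x y k₃ * e k₁ x * e k₂ y)
  integrable_F : Integrable (fun z => F f k₁ k₂ z * e k₃ z)
  integrable_G : Integrable (fun y => G f k₁ y k₃ * e k₂ y)
  integrable_H : Integrable (fun x => H f x k₂ k₃ * e k₁ x)

end

end NormalFourier

/-!
Three integrations by parts in `x` turn the transform in `x` into `(i k₁)⁻³` times the transform of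
`∂ₓ³ f`. The latter is `O(|v|⁻⁴)`, and sharing the exponent among the variables bounds it by a
multiple of `(1 + x²)^(-2/3) (1 + y²)^(-2/3) (1 + z²)^(-2/3)`, so it is absolutely integrable over
space and Fubini's theorem applies to all of its truncated and full transforms. The boundary terms
vanish uniformly in the truncations of `y` and `z`: by one more integration by parts, an oscillatory
integral whose amplitude is bounded by `M` and has derivative bounded by `M b` with `b` integrable
is `O(M)`, and here `M` tends to zero as `|x| → ∞`. Hence the integrals over boxes converge to the
transform that starts with `x`. A box integral does not depend on the order of the variables, so the
six transforms, being limits of the same box integrals, coincide.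
-/

namespace NormalFourier

noncomputable section

section DirDeriv

variable {E V : Type*} [NormedAddCommGroup E] [NormedSpace ℝ E] [NormedAddCommGroup V]
  [NormedSpace ℝ V] {g : E → V}

/-- The derivative in the constant direction `v`, as an operator on functions, so that it can be
iterated. -/
def dirDeriv (v : E) (g : E → V) (p : E) : V := fderiv ℝ g p v

lemma contDiff_dirDeriv {n : ℕ} (hg : ContDiff ℝ (n + 1 : ℕ) g) (v : E) :
    ContDiff ℝ n (dirDeriv v g) :=
  (hg.fderiv_right (by push_cast; exact le_rfl)).clm_apply contDiff_const

lemma contDiff_iterate_dirDeriv {m n : ℕ} (hg : ContDiff ℝ (n + m : ℕ) g) (v : E) :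
    ContDiff ℝ n ((dirDeriv v)^[m] g) := by
  induction m generalizing g with
  | zero => exact hg
  | succ m ih => exact ih (contDiff_dirDeriv hg v)

lemma dirDeriv_dirDeriv_apply (hg : ContDiff ℝ 2 g) (v w p : E) :
    dirDeriv v (dirDeriv w g) p = fderiv ℝ (fderiv ℝ g) p v w := by
  have hd : DifferentiableAt ℝ (fderiv ℝ g) p :=
    (hg.fderiv_right (m := 1) (by norm_num)).differentiable one_ne_zero p
  change fderiv ℝ (fun q => fderiv ℝ g q w) p v = _
  simp [fderiv_clm_apply hd (differentiableAt_const w)]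

lemma dirDeriv_comm (hg : ContDiff ℝ 2 g) (v w : E) :
    dirDeriv v (dirDeriv w g) = dirDeriv w (dirDeriv v g) := by
  funext p
  rw [dirDeriv_dirDeriv_apply hg, dirDeriv_dirDeriv_apply hg]
  exact hg.contDiffAt.isSymmSndFDerivAt (by simp) v w

lemma dirDeriv_iterate_dirDeriv_comm {n : ℕ} (hg : ContDiff ℝ (n + 1 : ℕ) g) (v w : E) :
    dirDeriv v ((dirDeriv w)^[n] g) = (dirDeriv w)^[n] (dirDeriv v g) := by
  induction n generalizing g with
  | zero => rfl
  | succ n ih =>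
    rw [Function.iterate_succ_apply, Function.iterate_succ_apply, ih (contDiff_dirDeriv hg w),
      dirDeriv_comm (hg.of_le (by exact_mod_cast (by omega : 2 ≤ n + 1 + 1)))]

lemma iterate_dirDeriv_comm {m n : ℕ} (hg : ContDiff ℝ (m + n : ℕ) g) (v w : E) :
    (dirDeriv v)^[m] ((dirDeriv w)^[n] g) = (dirDeriv w)^[n] ((dirDeriv v)^[m] g) := by
  induction m generalizing g with
  | zero => rfl
  | succ m ih =>
    rw [Function.iterate_succ_apply, Function.iterate_succ_apply,
      dirDeriv_iterate_dirDeriv_comm (hg.of_le (by exact_mod_cast (by omega : n + 1 ≤ m + 1 + n)))]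
    exact ih (contDiff_dirDeriv (hg.of_le (by exact_mod_cast (by omega))) v)

lemma hasDerivAt_comp_curve (hg : ContDiff ℝ 1 g) {γ : ℝ → E} {v : E} {t : ℝ}
    (hγ : HasDerivAt γ v t) : HasDerivAt (fun s => g (γ s)) (dirDeriv v g (γ t)) t :=
  (hg.differentiable one_ne_zero (γ t)).hasFDerivAt.comp_hasDerivAt t hγ

lemma iteratedDeriv_comp_curve {n : ℕ} (hg : ContDiff ℝ n g) {γ : ℝ → E} {v : E}
    (hγ : ∀ t, HasDerivAt γ v t) :
    iteratedDeriv n (fun t => g (γ t)) = fun t => (dirDeriv v)^[n] g (γ t) := by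
  induction n generalizing g with
  | zero => simp
  | succ n ih =>
    have hderiv : deriv (fun t => g (γ t)) = fun t => dirDeriv v g (γ t) := funext fun t =>
      (hasDerivAt_comp_curve (hg.of_le (by exact_mod_cast (by omega : 1 ≤ n + 1))) (hγ t)).deriv
    rw [iteratedDeriv_succ', hderiv, ih (contDiff_dirDeriv hg v), Function.iterate_succ]
    rfl

end DirDeriv

section PartialDeriv

lemma hasDerivAt_line_fst (y z t : ℝ) :
    HasDerivAt (fun s : ℝ => (s, y, z)) ((1, 0, 0) : ℝ × ℝ × ℝ) t :=
  (hasDerivAt_id t).prodMk ((hasDerivAt_const t y).prodMk (hasDerivAt_const t z))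

lemma hasDerivAt_line_snd (x z t : ℝ) :
    HasDerivAt (fun s : ℝ => (x, s, z)) ((0, 1, 0) : ℝ × ℝ × ℝ) t :=
  (hasDerivAt_const t x).prodMk ((hasDerivAt_id t).prodMk (hasDerivAt_const t z))

lemma hasDerivAt_line_thd (x y t : ℝ) :
    HasDerivAt (fun s : ℝ => (x, y, s)) ((0, 0, 1) : ℝ × ℝ × ℝ) t :=
  (hasDerivAt_const t x).prodMk ((hasDerivAt_const t y).prodMk (hasDerivAt_id t))

lemma iteratedDeriv_fst {n : ℕ} {g : ℝ × ℝ × ℝ → ℝ} (hg : ContDiff ℝ n g) (x y z : ℝ) :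
    iteratedDeriv n (fun t => g (t, y, z)) x = (dirDeriv (1, 0, 0))^[n] g (x, y, z) :=
  congrFun (iteratedDeriv_comp_curve hg (hasDerivAt_line_fst y z)) x

lemma iteratedDeriv_snd {n : ℕ} {g : ℝ × ℝ × ℝ → ℝ} (hg : ContDiff ℝ n g) (x y z : ℝ) :
    iteratedDeriv n (fun t => g (x, t, z)) y = (dirDeriv (0, 1, 0))^[n] g (x, y, z) :=
  congrFun (iteratedDeriv_comp_curve hg (hasDerivAt_line_snd x z)) y

lemma iteratedDeriv_thd {n : ℕ} {g : ℝ × ℝ × ℝ → ℝ} (hg : ContDiff ℝ n g) (x y z : ℝ) :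
    iteratedDeriv n (fun t => g (x, y, t)) z = (dirDeriv (0, 0, 1))^[n] g (x, y, z) :=
  congrFun (iteratedDeriv_comp_curve hg (hasDerivAt_line_thd x y)) z

variable {g : ℝ × ℝ × ℝ → ℝ} {i j k : ℕ}

lemma partialDeriv_eq_iterate_dirDeriv (hg : ContDiff ℝ (i + j + k : ℕ) g) (x y z : ℝ) :
    partialDeriv i j k (fun x y z => g (x, y, z)) x y z =
      (dirDeriv (1, 0, 0))^[i] ((dirDeriv (0, 1, 0))^[j] ((dirDeriv (0, 0, 1))^[k] g))
        (x, y, z) := by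
  have hk : ContDiff ℝ k g := hg.of_le (by exact_mod_cast (by omega))
  have hij : ContDiff ℝ (i + j : ℕ) ((dirDeriv (0, 0, 1))^[k] g) := contDiff_iterate_dirDeriv hg _
  have hj := hij.of_le (m := j) (by exact_mod_cast (by omega))
  simp only [partialDeriv, iteratedDeriv_thd hk, iteratedDeriv_snd hj,
    iteratedDeriv_fst (contDiff_iterate_dirDeriv hij _)]

lemma continuous_partialDeriv (hg : ContDiff ℝ (i + j + k : ℕ) g) :
    Continuous fun p : ℝ × ℝ × ℝ =>
      partialDeriv i j k (fun x y z => g (x, y, z)) p.1 p.2.1 p.2.2 := by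
  simp only [partialDeriv_eq_iterate_dirDeriv hg]
  refine (contDiff_iterate_dirDeriv (n := 0) (contDiff_iterate_dirDeriv
    (contDiff_iterate_dirDeriv (hg.of_le ?_) _) _) _).continuous
  exact_mod_cast (by omega)

lemma hasDerivAt_partialDeriv_fst (hg : ContDiff ℝ (i + j + k + 1 : ℕ) g) (x y z : ℝ) :
    HasDerivAt (fun t => partialDeriv i j k (fun x y z => g (x, y, z)) t y z)
      (partialDeriv (i + 1) j k (fun x y z => g (x, y, z)) x y z) x := by
  have hg' : ContDiff ℝ (i + 1 + j + k : ℕ) g := hg.of_le (by exact_mod_cast (by omega))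
  simp only [partialDeriv_eq_iterate_dirDeriv hg',
    partialDeriv_eq_iterate_dirDeriv (hg.of_le (by exact_mod_cast Nat.le_succ _)),
    Function.iterate_succ_apply']
  refine hasDerivAt_comp_curve (contDiff_iterate_dirDeriv (n := 1) (contDiff_iterate_dirDeriv
    (contDiff_iterate_dirDeriv (hg.of_le ?_) _) _) _) (hasDerivAt_line_fst y z x)
  exact_mod_cast (by omega)

lemma partialDeriv_swap_fst (hg : ContDiff ℝ (i + j + k : ℕ) g) (x y z : ℝ) :
    partialDeriv j i k (fun y x z => g (x, y, z)) y x z =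
      partialDeriv i j k (fun x y z => g (x, y, z)) x y z := by
  have hk : ContDiff ℝ k g := hg.of_le (by exact_mod_cast (by omega))
  have hij : ContDiff ℝ (i + j : ℕ) ((dirDeriv (0, 0, 1))^[k] g) := contDiff_iterate_dirDeriv hg _
  have hi := hij.of_le (m := i) (by exact_mod_cast (by omega))
  have hji := hij.of_le (m := (j + i : ℕ)) (by exact_mod_cast (by omega))
  rw [partialDeriv_eq_iterate_dirDeriv hg, iterate_dirDeriv_comm hij]
  simp only [partialDeriv, iteratedDeriv_thd hk, iteratedDeriv_fst hi,
    iteratedDeriv_snd (contDiff_iterate_dirDeriv hji _)]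

lemma partialDeriv_swap_snd (hg : ContDiff ℝ (i + j + k : ℕ) g) (x y z : ℝ) :
    partialDeriv i k j (fun x z y => g (x, y, z)) x z y =
      partialDeriv i j k (fun x y z => g (x, y, z)) x y z := by
  have hj : ContDiff ℝ j g := hg.of_le (by exact_mod_cast (by omega))
  have hjk : ContDiff ℝ (j + k : ℕ) g := hg.of_le (by exact_mod_cast (by omega))
  have hik : ContDiff ℝ (i + k : ℕ) ((dirDeriv (0, 1, 0))^[j] g) :=
    contDiff_iterate_dirDeriv (hg.of_le (by exact_mod_cast (by omega))) _
  have hk := hik.of_le (m := k) (by exact_mod_cast (by omega))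
  rw [partialDeriv_eq_iterate_dirDeriv hg, iterate_dirDeriv_comm hjk]
  simp only [partialDeriv, iteratedDeriv_snd hj, iteratedDeriv_thd hk,
    iteratedDeriv_fst (contDiff_iterate_dirDeriv hik _)]

end PartialDeriv

section IntervalIntegral

variable {V : Type*} [NormedAddCommGroup V] [NormedSpace ℝ V]

lemma tendsto_fst_atTop {α β : Type*} [Preorder α] [Preorder β] :
    Tendsto (Prod.fst : α × β → α) atTop atTop := by
  rw [← prod_atTop_atTop_eq]
  exact tendsto_fst

lemma tendsto_snd_atTop {α β : Type*} [Preorder α] [Preorder β] :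
    Tendsto (Prod.snd : α × β → β) atTop atTop := by
  rw [← prod_atTop_atTop_eq]
  exact tendsto_snd

lemma norm_intervalIntegral_le_integral {g : ℝ → V} {b : ℝ → ℝ} (hb : Integrable b)
    (hg : ∀ x, ‖g x‖ ≤ b x) (u v : ℝ) : ‖∫ x in u..v, g x‖ ≤ ∫ x, b x := by
  have hb0 : 0 ≤ b := fun x => (norm_nonneg _).trans (hg x)
  refine (intervalIntegral.norm_integral_le_abs_of_norm_le (Eventually.of_forall hg)
    hb.intervalIntegrable).trans ?_
  rw [intervalIntegral.abs_intervalIntegral_eq, abs_of_nonneg (integral_nonneg hb0)]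
  exact setIntegral_le_integral hb (Eventually.of_forall hb0)

lemma tendsto_intervalIntegral_of_dominated {ι : Type*} {l : Filter ι} [l.IsCountablyGenerated]
    {h : ι → ℝ → V} {h₀ : ℝ → V} {s : ι → ℝ} {b : ℝ → ℝ}
    (hmeas : ∀ i, AEStronglyMeasurable (h i)) (hb : Integrable b)
    (hbound : ∀ i y, ‖h i y‖ ≤ b y) (hs : Tendsto s l atTop)
    (hlim : ∀ y, Tendsto (fun i => h i y) l (𝓝 (h₀ y))) :
    Tendsto (fun i => ∫ y in -s i..s i, h i y) l (𝓝 (∫ y, h₀ y)) := by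
  have hindicator : Tendsto (fun i => ∫ y, (Set.Ioc (-s i) (s i)).indicator (h i) y) l
      (𝓝 (∫ y, h₀ y)) := by
    refine tendsto_integral_filter_of_dominated_convergence b
      (.of_forall fun i => (hmeas i).indicator measurableSet_Ioc)
      (.of_forall fun i => .of_forall fun y =>
        (norm_indicator_le_norm_self _ _).trans (hbound i y)) hb
      (.of_forall fun y => (hlim y).congr' ?_)
    filter_upwards [hs.eventually_gt_atTop |y|] with i hi
    rw [Set.indicator_of_mem]
    exact ⟨by linarith [neg_abs_le y], by linarith [le_abs_self y]⟩
  refine hindicator.congr' ?_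
  filter_upwards [hs.eventually_ge_atTop 0] with i hi
  rw [integral_indicator measurableSet_Ioc, intervalIntegral.integral_of_le (by linarith)]

lemma intervalIntegral_swap_of_continuous {g : ℝ → ℝ → V} (hg : Continuous g.uncurry)
    (a b c d : ℝ) : ∫ x in a..b, ∫ y in c..d, g x y = ∫ y in c..d, ∫ x in a..b, g x y := by
  refine intervalIntegral_intervalIntegral_swap ?_
  refine (hg.continuousOn.integrableOn_compact
    ((isCompact_uIcc (a := a) (b := b)).prod (isCompact_uIcc (a := c) (b := d)))).mono_set ?_
  exact Set.prod_mono Set.uIoc_subset_uIcc Set.uIoc_subset_uIcc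

lemma hasDerivAt_intervalIntegral_of_continuous {g g' : ℝ → ℝ → V}
    (hg : Continuous g.uncurry) (hg' : Continuous g'.uncurry)
    (hderiv : ∀ x y, HasDerivAt (fun t => g t y) (g' x y) x) (a b x : ℝ) :
    HasDerivAt (fun t => ∫ y in a..b, g t y) (∫ y in a..b, g' x y) x := by
  obtain ⟨M, hM⟩ := ((isCompact_closedBall x 1).prod
    (isCompact_uIcc (a := a) (b := b))).exists_bound_of_continuousOn hg'.continuousOn
  refine (intervalIntegral.hasDerivAt_integral_of_dominated_loc_of_deriv_le
    (bound := fun _ => M) (Metric.closedBall_mem_nhds x one_pos)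
    (.of_forall fun t => ?_) (Continuous.intervalIntegrable ?_ _ _) ?_
    (.of_forall fun y hy t ht => hM (t, y) ⟨ht, Set.uIoc_subset_uIcc hy⟩)
    intervalIntegrable_const (.of_forall fun y _ t _ => hderiv t y)).2
  · exact (hg.comp (Continuous.prodMk_right t)).aestronglyMeasurable
  · exact hg.comp (Continuous.prodMk_right x)
  · exact (hg'.comp (Continuous.prodMk_right x)).aestronglyMeasurable

lemma integrable_of_norm_le_mul_mul {E : Type*} [NormedAddCommGroup E] {g : ℝ × ℝ × ℝ → E}
    {b c d : ℝ → ℝ} {M : ℝ} (hg : Continuous g) (hb : Integrable b) (hc : Integrable c)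
    (hd : Integrable d) (hle : ∀ x y z, ‖g (x, y, z)‖ ≤ M * (b x * (c y * d z))) :
    Integrable g :=
  ((hb.mul_prod (hc.mul_prod hd)).const_mul M).mono' hg.aestronglyMeasurable
    (.of_forall fun p => hle p.1 p.2.1 p.2.2)

end IntervalIntegral

section Oscillatory

lemma norm_e (k x : ℝ) : ‖e k x‖ = 1 := by
  rw [e, Complex.norm_exp]
  simp

lemma norm_mul_e (c : ℂ) (k x : ℝ) : ‖c * e k x‖ = ‖c‖ := by
  rw [norm_mul, norm_e, mul_one]

@[fun_prop]
lemma continuous_e (k : ℝ) : Continuous (e k) := by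
  unfold e
  fun_prop

lemma hasDerivAt_e (k x : ℝ) : HasDerivAt (e k) (-(Complex.I * k) * e k x) x := by
  have hexp : HasDerivAt (e k) (e k x * -(Complex.I * k * 1)) x :=
    ((Complex.ofRealCLM.hasDerivAt (x := x)).const_mul (Complex.I * k)).fun_neg.cexp
  rwa [mul_one, mul_comm] at hexp

lemma intervalIntegral_mul_e_swap {g : ℝ → ℝ → ℂ} (hg : Continuous g.uncurry) (k l a b c d : ℝ) :
    ∫ x in a..b, (∫ y in c..d, g x y * e l y) * e k x =
      ∫ y in c..d, (∫ x in a..b, g x y * e k x) * e l y := by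
  simp only [← intervalIntegral.integral_mul_const]
  rw [intervalIntegral_swap_of_continuous (by fun_prop)]
  simp only [mul_right_comm]

lemma integrable_mul_e {α : Type*} [MeasurableSpace α] {μ : Measure α} {g : α → ℂ} {φ : α → ℝ}
    (hg : Integrable g μ) (hφ : Measurable φ) (k : ℝ) :
    Integrable (fun a => g a * e k (φ a)) μ :=
  hg.mul_bdd (c := 1) ((continuous_e k).measurable.comp hφ).aestronglyMeasurable
    (.of_forall fun a => (norm_e k (φ a)).le)

lemma integral_mul_e_swap {g : ℝ × ℝ → ℂ} (hg : Integrable g) (k l : ℝ) :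
    ∫ x, (∫ y, g (x, y) * e l y) * e k x = ∫ y, (∫ x, g (x, y) * e k x) * e l y := by
  simp only [← integral_mul_const]
  rw [integral_integral_swap (integrable_mul_e (integrable_mul_e hg measurable_snd l)
    measurable_fst k)]
  simp only [mul_right_comm]

variable {k l : ℝ}

lemma integral_mul_e_by_parts (hk : k ≠ 0) {g g' : ℝ → ℂ} (hg : ∀ x, HasDerivAt g (g' x) x)
    (hg' : Continuous g') (a b : ℝ) :
    ∫ x in a..b, g x * e k x =
      (Complex.I * k)⁻¹ * (g a * e k a - g b * e k b + ∫ x in a..b, g' x * e k x) := by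
  have hparts := intervalIntegral.integral_mul_deriv_eq_deriv_mul (a := a) (b := b)
    (fun x _ => hg x) (fun x _ => hasDerivAt_e k x) (hg'.intervalIntegrable _ _)
    (Continuous.intervalIntegrable (by fun_prop) _ _)
  simp only [mul_left_comm (g _), intervalIntegral.integral_const_mul] at hparts
  have hIk : Complex.I * (k : ℂ) ≠ 0 := mul_ne_zero Complex.I_ne_zero (by exact_mod_cast hk)
  rw [eq_inv_mul_iff_mul_eq₀ hIk]
  linear_combination -hparts

/-- The constant in the bound for an oscillatory integral with frequency `k` whose amplitude `g`
satisfies `‖g‖ ≤ M` and `‖g'‖ ≤ M * b`. -/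
def oscConst (k : ℝ) (b : ℝ → ℝ) : ℝ := ‖(Complex.I * (k : ℂ))⁻¹‖ * (2 + ∫ x, b x)

lemma norm_integral_mul_e_le (hk : k ≠ 0) {g g' : ℝ → ℂ} {b : ℝ → ℝ} {M : ℝ}
    (hg : ∀ x, HasDerivAt g (g' x) x) (hg' : Continuous g') (hb : Integrable b)
    (hM : ∀ x, ‖g x‖ ≤ M) (hM' : ∀ x, ‖g' x‖ ≤ M * b x) (u v : ℝ) :
    ‖∫ x in u..v, g x * e k x‖ ≤ oscConst k b * M := by
  have hint : ‖∫ x in u..v, g' x * e k x‖ ≤ M * ∫ x, b x := by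
    rw [← integral_const_mul]
    exact norm_intervalIntegral_le_integral (hb.const_mul M)
      (fun x => (norm_mul_e _ k x).trans_le (hM' x)) u v
  rw [integral_mul_e_by_parts hk hg hg', norm_mul, oscConst, mul_assoc]
  gcongr
  calc ‖g u * e k u - g v * e k v + ∫ x in u..v, g' x * e k x‖
      ≤ ‖g u * e k u‖ + ‖g v * e k v‖ + ‖∫ x in u..v, g' x * e k x‖ :=
        (norm_add_le _ _).trans (by gcongr; exact norm_sub_le _ _)
    _ ≤ M + M + M * ∫ x, b x := by
        gcongr
        · exact (norm_mul_e _ k u).trans_le (hM u)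
        · exact (norm_mul_e _ k v).trans_le (hM v)
    _ = (2 + ∫ x, b x) * M := by ring

lemma norm_integral_integral_mul_e_le (hk : k ≠ 0) (hl : l ≠ 0) {g gx gy gxy : ℝ → ℝ → ℂ}
    {b c : ℝ → ℝ} {M : ℝ} (hg : Continuous g.uncurry) (hgx : Continuous gx.uncurry)
    (hgy : Continuous gy.uncurry) (hgxy : Continuous gxy.uncurry)
    (hx : ∀ x y, HasDerivAt (fun t => g t y) (gx x y) x)
    (hy : ∀ x y, HasDerivAt (g x) (gy x y) y) (hxy : ∀ x y, HasDerivAt (gx x) (gxy x y) y)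
    (hb : Integrable b) (hc : Integrable c) (hM : ∀ x y, ‖g x y‖ ≤ M)
    (hMx : ∀ x y, ‖gx x y‖ ≤ M * b x) (hMy : ∀ x y, ‖gy x y‖ ≤ M * c y)
    (hMxy : ∀ x y, ‖gxy x y‖ ≤ M * b x * c y) (u v s t : ℝ) :
    ‖∫ x in u..v, (∫ y in s..t, g x y * e l y) * e k x‖ ≤ oscConst k b * (oscConst l c * M) := by
  have hinner : ∀ x, HasDerivAt (fun x => ∫ y in s..t, g x y * e l y)
      (∫ y in s..t, gx x y * e l y) x :=
    hasDerivAt_intervalIntegral_of_continuous (by fun_prop) (by fun_prop)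
      (fun x y => (hx x y).mul_const _) s t
  refine norm_integral_mul_e_le hk hinner (by fun_prop) hb (fun x => ?_) (fun x => ?_) u v
  · exact norm_integral_mul_e_le hl (hy x) (hgy.comp (Continuous.prodMk_right x)) hc (hM x)
      (hMy x) s t
  · rw [mul_assoc]
    exact norm_integral_mul_e_le hl (hxy x) (hgxy.comp (Continuous.prodMk_right x)) hc (hMx x)
      (hMxy x) s t

lemma tendsto_integral_mul_e_of_iterated_parts {ι : Type*} {L : Filter ι}
    [L.IsCountablyGenerated] (hk : k ≠ 0) {n : ℕ} {g : ℕ → ι → ℝ → ℂ} {g₀ : ℝ → ℂ} {b c : ℝ → ℝ}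
    {r : ι → ℝ} (hcont : ∀ m ≤ n, ∀ i, Continuous (g m i))
    (hderiv : ∀ m < n, ∀ i x, HasDerivAt (g m i) (g (m + 1) i x) x)
    (hc : Tendsto c (cocompact ℝ) (𝓝 0)) (hgc : ∀ m < n, ∀ i x, ‖g m i x‖ ≤ c x)
    (hb : Integrable b) (hgb : ∀ i x, ‖g n i x‖ ≤ b x)
    (hlim : ∀ x, Tendsto (fun i => g n i x) L (𝓝 (g₀ x))) (hr : Tendsto r L atTop) :
    Tendsto (fun i => ∫ x in -r i..r i, g 0 i x * e k x) L
      (𝓝 ((Complex.I * k)⁻¹ ^ n * ∫ x, g₀ x * e k x)) := by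
  induction n generalizing g with
  | zero =>
    rw [pow_zero, one_mul]
    exact tendsto_intervalIntegral_of_dominated
      (fun i => ((hcont 0 le_rfl i).mul (continuous_e k)).aestronglyMeasurable) hb
      (fun i x => (norm_mul_e _ k x).trans_le (hgb i x)) hr (fun x => (hlim x).mul_const _)
  | succ n ih =>
    have hrest := ih (g := fun m => g (m + 1)) (fun m hm => hcont (m + 1) (by omega))
      (fun m hm => hderiv (m + 1) (by omega)) (fun m hm => hgc (m + 1) (by omega)) hgb hlim
    have hboundary : ∀ s : ι → ℝ, Tendsto s L (cocompact ℝ) →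
        Tendsto (fun i => g 0 i (s i) * e k (s i)) L (𝓝 0) := fun s hs =>
      squeeze_zero_norm (fun i => (norm_mul_e _ k _).trans_le (hgc 0 n.succ_pos i _))
        (hc.comp hs)
    have hright := hboundary r (hr.mono_right atTop_le_cocompact)
    have hleft := hboundary (fun i => -r i)
      ((tendsto_neg_atTop_atBot.comp hr).mono_right atBot_le_cocompact)
    have hsum := ((hleft.sub hright).add hrest).const_mul (Complex.I * (k : ℂ))⁻¹
    rw [sub_zero, zero_add (_ * _), ← mul_assoc, ← pow_succ'] at hsum
    exact hsum.congr fun i => (integral_mul_e_by_parts hk (hderiv 0 n.succ_pos i)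
      (hcont 1 (by omega) i) _ _).symm

end Oscillatory

section Weight

/-- The power `(1 + u²)^(-a)`. Bounds on functions of three variables are split into products of
such weights in the single variables; a weight is integrable for `a > 1/2` and vanishes at infinity
for `a > 0`. -/
def weight (a u : ℝ) : ℝ := (1 + u ^ 2) ^ (-a)

lemma weight_nonneg (a u : ℝ) : 0 ≤ weight a u := by
  unfold weight
  positivity

lemma weight_mul_natCast (a : ℝ) (n : ℕ) (u : ℝ) : weight (a * n) u = weight a u ^ n := by
  rw [weight, weight, ← neg_mul, Real.rpow_mul_natCast (by positivity)]

lemma integrable_weight {a : ℝ} (ha : 1 / 2 < a) : Integrable (weight a) := by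
  have hint := integrable_rpow_neg_one_add_norm_sq (E := ℝ) (μ := volume) (r := 2 * a)
    (by simp; linarith)
  refine hint.congr (.of_forall fun u => ?_)
  simp only [weight, Real.norm_eq_abs, sq_abs]
  congr 1
  ring

lemma tendsto_weight_cocompact {a : ℝ} (ha : 0 < a) :
    Tendsto (weight a) (cocompact ℝ) (𝓝 0) := by
  have hsq : Tendsto (fun u : ℝ => 1 + u ^ 2) (cocompact ℝ) atTop := by
    refine tendsto_atTop_add_const_left _ _ ?_
    simpa only [Function.comp_def, Real.norm_eq_abs, sq_abs]
      using (tendsto_pow_atTop two_ne_zero).comp (tendsto_norm_cocompact_atTop (E := ℝ))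
  exact (tendsto_rpow_neg_atTop ha).comp hsq

lemma tendsto_const_mul_weight_cocompact (c : ℝ) {a : ℝ} (ha : 0 < a) :
    Tendsto (fun u => c * weight a u) (cocompact ℝ) (𝓝 0) := by
  simpa only [mul_zero] using (tendsto_weight_cocompact ha).const_mul c

lemma rpow_neg_le_weight {a u q : ℝ} (ha : 0 ≤ a) (hu : 1 + u ^ 2 ≤ q) : q ^ (-a) ≤ weight a u :=
  Real.rpow_le_rpow_of_nonpos (by positivity) hu (by linarith)

lemma rpow_neg_le_weight_mul {a b c d : ℝ} (ha : 0 ≤ a) (hb : 0 ≤ b) (hc : 0 ≤ c)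
    (hd : a + b + c ≤ d) (x y z : ℝ) :
    (1 + x ^ 2 + y ^ 2 + z ^ 2) ^ (-d) ≤ weight a x * (weight b y * weight c z) := by
  have hx := sq_nonneg x
  have hy := sq_nonneg y
  have hz := sq_nonneg z
  set q := 1 + x ^ 2 + y ^ 2 + z ^ 2
  have hq : 0 < q := by positivity
  calc q ^ (-d) ≤ q ^ (-a + (-b + -c)) :=
        Real.rpow_le_rpow_of_exponent_le (by linarith) (by linarith)
    _ = q ^ (-a) * (q ^ (-b) * q ^ (-c)) := by rw [Real.rpow_add hq, Real.rpow_add hq]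
    _ ≤ weight a x * (weight b y * weight c z) := by
        have := weight_nonneg a x
        have := weight_nonneg b y
        gcongr <;> exact rpow_neg_le_weight ‹_› (by linarith)

end Weight

section Decay

lemma Decrease₃.exists_bound {n : ℕ} {g : ℝ → ℝ → ℝ → ℝ} (hg : Decrease₃ n g)
    (hcont : Continuous (fun p : ℝ × ℝ × ℝ => g p.1 p.2.1 p.2.2)) :
    ∃ K, ∀ x y z, |g x y z| ≤ K * (1 + x ^ 2 + y ^ 2 + z ^ 2) ^ (-(n : ℝ) / 2) := by
  obtain ⟨c, hc, hgc⟩ := hg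
  obtain ⟨M, hM⟩ := ((isCompact_Icc (a := (-1 : ℝ)) (b := 1)).prod (isCompact_Icc.prod
    isCompact_Icc)).exists_bound_of_continuousOn (f := fun p : ℝ × ℝ × ℝ =>
      |g p.1 p.2.1 p.2.2| * √(1 + (p.1 ^ 2 + p.2.1 ^ 2 + p.2.2 ^ 2)) ^ n)
    (Continuous.continuousOn (by fun_prop))
  refine ⟨max M (c * 2 ^ n), fun x y z => ?_⟩
  have hx := sq_nonneg x
  have hy := sq_nonneg y
  have hz := sq_nonneg z
  rw [neg_div, Real.rpow_neg (by positivity), Real.rpow_div_two_eq_sqrt _ (by positivity),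
    Real.rpow_natCast, ← div_eq_mul_inv, le_div_iff₀ (by positivity), add_assoc, add_assoc,
    ← add_assoc (x ^ 2)]
  set q := x ^ 2 + y ^ 2 + z ^ 2
  have hq : 0 ≤ q := by positivity
  rcases lt_or_ge 1 (√q) with hout | hin
  · have hsqrt : √(1 + q) ≤ √q * 2 := by
      rw [Real.sqrt_le_left (by positivity), mul_pow, Real.sq_sqrt hq]
      nlinarith [Real.sq_sqrt hq]
    calc |g x y z| * √(1 + q) ^ n ≤ c / √q ^ n * (√q * 2) ^ n := by
          gcongr
          exact hgc x y z hout
      _ = c * 2 ^ n := by rw [mul_pow]; field_simp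
      _ ≤ max M (c * 2 ^ n) := le_max_right _ _
  · have hq1 : q ≤ 1 := by simpa using hin
    have hmem : ∀ t : ℝ, t ^ 2 ≤ q → t ∈ Set.Icc (-1) 1 := fun t ht =>
      Set.mem_Icc.2 (abs_le.1 (sq_le_one_iff_abs_le_one t |>.1 (ht.trans hq1)))
    exact (le_abs_self _).trans <| (hM (x, y, z) ⟨hmem x (by grind), hmem y (by grind),
      hmem z (by grind)⟩).trans (le_max_left _ _)

/-- The class of functions to which the argument applies: `f` is of class `C⁴`, and its partial
derivatives of order `n ≤ 4` are bounded by `K (1 + |v|²)^(-(n+1)/2)` everywhere, with the same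
constant `K` for all of them. -/
structure DecayingPartials (K : ℝ) (f : ℝ → ℝ → ℝ → ℝ) : Prop where
  contDiff : ContDiff ℝ 4 (fun p : ℝ × ℝ × ℝ => f p.1 p.2.1 p.2.2)
  abs_le : ∀ i j k, i + j + k ≤ 4 → ∀ x y z, |partialDeriv i j k f x y z| ≤
    K * (1 + x ^ 2 + y ^ 2 + z ^ 2) ^ (-((i + j + k + 1 : ℕ) : ℝ) / 2)

/-- The partial derivative of `f` as a complex-valued function on triples. -/
def mixedDeriv (f : ℝ → ℝ → ℝ → ℝ) (i j k : ℕ) (p : ℝ × ℝ × ℝ) : ℂ :=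
  partialDeriv i j k f p.1 p.2.1 p.2.2

lemma exists_decayingPartials {f : ℝ → ℝ → ℝ → ℝ}
    (hf : ContDiff ℝ 4 (fun p : ℝ × ℝ × ℝ => f p.1 p.2.1 p.2.2))
    (hdecrease : ∀ i j k, i + j + k ≤ 4 → Decrease₃ (i + j + k + 1) (partialDeriv i j k f)) :
    ∃ K, DecayingPartials K f := by
  have hbound : ∀ i j k, ∃ K, i + j + k ≤ 4 → ∀ x y z, |partialDeriv i j k f x y z| ≤
      K * (1 + x ^ 2 + y ^ 2 + z ^ 2) ^ (-((i + j + k + 1 : ℕ) : ℝ) / 2) := fun i j k => by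
    by_cases hijk : i + j + k ≤ 4
    · exact ((hdecrease i j k hijk).exists_bound (continuous_partialDeriv
        (hf.of_le (by exact_mod_cast hijk)))).imp fun K hK _ => hK
    · exact ⟨0, fun h => absurd h hijk⟩
  choose K hK using hbound
  let s := Finset.range 5 ×ˢ Finset.range 5 ×ˢ Finset.range 5
  obtain ⟨M, hM⟩ := (s.image fun m => K m.1 m.2.1 m.2.2).bddAbove
  refine ⟨M, hf, fun i j k hijk x y z => (hK i j k hijk x y z).trans ?_⟩
  gcongr
  exact hM (Finset.mem_coe.2 (Finset.mem_image_of_mem (fun m : ℕ × ℕ × ℕ => K m.1 m.2.1 m.2.2)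
    (by simp only [s, Finset.mem_product, Finset.mem_range]; omega : (i, j, k) ∈ s)))

lemma Normal₃.decrease_partialDeriv {f : ℝ → ℝ → ℝ → ℝ} (hf : Normal₃ f) (i j k : ℕ) :
    Decrease₃ (i + j + k + 1) (partialDeriv i j k f) := by
  rcases Nat.eq_zero_or_pos (i + j + k) with hzero | hpos
  · obtain ⟨rfl, rfl, rfl⟩ : i = 0 ∧ j = 0 ∧ k = 0 := by omega
    exact hf.decrease
  · exact hf.decrease_deriv i j k hpos

namespace DecayingPartials

variable {K : ℝ} {f : ℝ → ℝ → ℝ → ℝ} {i j k : ℕ}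

lemma nonneg (h : DecayingPartials K f) : 0 ≤ K := by
  simpa using (abs_nonneg _).trans (h.abs_le 0 0 0 (by norm_num) 0 0 0)

lemma contDiff_of_le (h : DecayingPartials K f) {n : ℕ} (hn : n ≤ 4) :
    ContDiff ℝ n (fun p : ℝ × ℝ × ℝ => f p.1 p.2.1 p.2.2) :=
  h.contDiff.of_le (by exact_mod_cast hn)

lemma swap_fst (h : DecayingPartials K f) : DecayingPartials K (fun y x z => f x y z) where
  contDiff := h.contDiff.comp ((contDiff_fst.comp contDiff_snd).prodMk
    (contDiff_fst.prodMk (contDiff_snd.comp contDiff_snd)))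
  abs_le j i k hijk y x z := by
    rw [partialDeriv_swap_fst (h.contDiff_of_le (by omega))]
    convert h.abs_le i j k (by omega) x y z using 3
    · ring
    · rw [add_comm j i]

lemma swap_snd (h : DecayingPartials K f) : DecayingPartials K (fun x z y => f x y z) where
  contDiff := h.contDiff.comp (contDiff_fst.prodMk
    ((contDiff_snd.comp contDiff_snd).prodMk (contDiff_fst.comp contDiff_snd)))
  abs_le i k j hijk x z y := by
    rw [partialDeriv_swap_snd (h.contDiff_of_le (by omega))]
    convert h.abs_le i j k (by omega) x y z using 3
    · ring
    · rw [add_right_comm i]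

lemma continuous_mixedDeriv (h : DecayingPartials K f) (hijk : i + j + k ≤ 4) :
    Continuous (mixedDeriv f i j k) :=
  Complex.continuous_ofReal.comp (continuous_partialDeriv (h.contDiff_of_le hijk))

lemma hasDerivAt_fst (h : DecayingPartials K f) (hijk : i + j + k < 4) (x y z : ℝ) :
    HasDerivAt (fun t => mixedDeriv f i j k (t, y, z)) (mixedDeriv f (i + 1) j k (x, y, z)) x :=
  (hasDerivAt_partialDeriv_fst (h.contDiff_of_le hijk) x y z).ofReal_comp

lemma mixedDeriv_swap_fst (h : DecayingPartials K f) (hijk : i + j + k ≤ 4) (x y z : ℝ) :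
    mixedDeriv (fun y x z => f x y z) j i k (y, x, z) = mixedDeriv f i j k (x, y, z) :=
  congrArg _ (partialDeriv_swap_fst (h.contDiff_of_le hijk) x y z)

lemma mixedDeriv_swap_snd (h : DecayingPartials K f) (hijk : i + j + k ≤ 4) (x y z : ℝ) :
    mixedDeriv (fun x z y => f x y z) i k j (x, z, y) = mixedDeriv f i j k (x, y, z) :=
  congrArg _ (partialDeriv_swap_snd (h.contDiff_of_le hijk) x y z)

lemma hasDerivAt_snd (h : DecayingPartials K f) (hijk : i + j + k < 4) (x y z : ℝ) :
    HasDerivAt (fun t => mixedDeriv f i j k (x, t, z)) (mixedDeriv f i (j + 1) k (x, y, z)) y := by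
  simpa only [h.mixedDeriv_swap_fst hijk.le,
    h.mixedDeriv_swap_fst (by omega : i + (j + 1) + k ≤ 4)]
    using h.swap_fst.hasDerivAt_fst (i := j) (j := i) (k := k) (by omega) y x z

lemma hasDerivAt_thd (h : DecayingPartials K f) (hijk : i + j + k < 4) (x y z : ℝ) :
    HasDerivAt (fun t => mixedDeriv f i j k (x, y, t)) (mixedDeriv f i j (k + 1) (x, y, z)) z := by
  simpa only [h.mixedDeriv_swap_snd hijk.le,
    h.mixedDeriv_swap_snd (by omega : i + j + (k + 1) ≤ 4)]
    using h.swap_snd.hasDerivAt_snd (i := i) (j := k) (k := j) (by omega) x z y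

lemma norm_mixedDeriv_le (h : DecayingPartials K f) (hijk : i + j + k ≤ 4) {a b c : ℝ}
    (ha : 0 ≤ a) (hb : 0 ≤ b) (hc : 0 ≤ c) (habc : a + b + c ≤ ((i + j + k + 1 : ℕ) : ℝ) / 2)
    (x y z : ℝ) :
    ‖mixedDeriv f i j k (x, y, z)‖ ≤ K * (weight a x * (weight b y * weight c z)) := by
  rw [mixedDeriv, Complex.norm_real, Real.norm_eq_abs]
  refine (h.abs_le i j k hijk x y z).trans ?_
  rw [neg_div]
  exact mul_le_mul_of_nonneg_left (rpow_neg_le_weight_mul ha hb hc habc x y z) h.nonneg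

-- The decay `(|v|²)^(-2)` is shared equally between the variables, which leaves each of them an
-- integrable weight.
lemma norm_mixedDeriv_three_le (h : DecayingPartials K f) (x y z : ℝ) :
    ‖mixedDeriv f 3 0 0 (x, y, z)‖ ≤
      K * (weight (2 / 3) x * (weight (2 / 3) y * weight (2 / 3) z)) :=
  h.norm_mixedDeriv_le (by norm_num) (by norm_num) (by norm_num) (by norm_num) (by norm_num) x y z

-- Every derivative in `y` or `z` is turned into an integrable weight in that variable. For `i = 0`
-- and `j = k = 1` this leaves the exponent `3/2 - 2 * (2/3) = 1/6` for the decay in `x`.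
lemma norm_mixedDeriv_boundary_le (h : DecayingPartials K f) (hi : i < 3) (hj : j ≤ 1)
    (hk : k ≤ 1) (x y z : ℝ) :
    ‖mixedDeriv f i j k (x, y, z)‖ ≤
      K * weight (1 / 6) x * (weight (2 / 3) y ^ j * weight (2 / 3) z ^ k) := by
  have hj' : (j : ℝ) ≤ 1 := by exact_mod_cast hj
  have hk' : (k : ℝ) ≤ 1 := by exact_mod_cast hk
  rw [← weight_mul_natCast, ← weight_mul_natCast, mul_assoc]
  refine h.norm_mixedDeriv_le (by omega) (by norm_num) (by positivity) (by positivity) ?_ x y z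
  push_cast
  linarith [(Nat.cast_nonneg i : (0 : ℝ) ≤ i)]

end DecayingPartials

end Decay

section Transforms

lemma mixedDeriv_zero (f : ℝ → ℝ → ℝ → ℝ) (x y z : ℝ) : mixedDeriv f 0 0 0 (x, y, z) = f x y z := by
  simp only [mixedDeriv, partialDeriv, iteratedDeriv_zero]

lemma hatA_eq_integral (f : ℝ → ℝ → ℝ → ℝ) (k₁ k₂ k₃ : ℝ) :
    hatA f k₁ k₂ k₃ = ∫ z, (∫ y, A f k₁ y z * e k₂ y) * e k₃ z := by
  simp only [hatA, integral_mul_const]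

namespace DecayingPartials

variable {K : ℝ} {f : ℝ → ℝ → ℝ → ℝ} {k₁ k₂ k₃ : ℝ}

lemma continuous_mixedDeriv_fst (h : DecayingPartials K f) {i : ℕ} (hi : i ≤ 3) :
    Continuous (mixedDeriv f i 0 0) :=
  h.continuous_mixedDeriv (by omega)

lemma truncF_eq (h : DecayingPartials K f) (k₁ k₂ z : ℝ) (p : ℝ × ℝ) :
    truncF f k₁ k₂ z p =
      ∫ x in -p.1..p.1, (∫ y in -p.2..p.2, mixedDeriv f 0 0 0 (x, y, z) * e k₂ y) * e k₁ x := by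
  have hcont := h.continuous_mixedDeriv_fst (Nat.zero_le 3)
  rw [intervalIntegral_mul_e_swap (g := fun x y => mixedDeriv f 0 0 0 (x, y, z)) (by fun_prop)]
  simp only [truncF, mixedDeriv_zero, intervalIntegral.integral_mul_const]

lemma truncBox_eq (h : DecayingPartials K f) (k₁ k₂ k₃ : ℝ) (p : ℝ × ℝ × ℝ) :
    truncBox f k₁ k₂ k₃ p = ∫ x in -p.1..p.1, (∫ z in -p.2.2..p.2.2, (∫ y in -p.2.1..p.2.1,
      mixedDeriv f 0 0 0 (x, y, z) * e k₂ y) * e k₃ z) * e k₁ x := by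
  have hcont := h.continuous_mixedDeriv_fst (Nat.zero_le 3)
  have htruncF : truncBox f k₁ k₂ k₃ p =
      ∫ z in -p.2.2..p.2.2, truncF f k₁ k₂ z (p.1, p.2.1) * e k₃ z := by
    simp only [truncBox, truncF, intervalIntegral.integral_mul_const]
  simp only [htruncF, h.truncF_eq]
  rw [intervalIntegral_mul_e_swap (g := fun x z => ∫ y in -p.2.1..p.2.1,
    mixedDeriv f 0 0 0 (x, y, z) * e k₂ y) (by fun_prop)]

lemma truncBox_swap_fst (h : DecayingPartials K f) (k₁ k₂ k₃ r s t : ℝ) :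
    truncBox (fun y x z => f x y z) k₂ k₁ k₃ (s, r, t) = truncBox f k₁ k₂ k₃ (r, s, t) := by
  have hcont := h.continuous_mixedDeriv_fst (Nat.zero_le 3)
  simp only [truncBox, ← mixedDeriv_zero f, intervalIntegral.integral_mul_const]
  refine intervalIntegral.integral_congr fun z _ => congrArg (· * e k₃ z) ?_
  exact intervalIntegral_mul_e_swap (g := fun x y => mixedDeriv f 0 0 0 (x, y, z)) (by fun_prop) ..

lemma truncBox_swap_snd (h : DecayingPartials K f) (k₁ k₂ k₃ r s t : ℝ) :
    truncBox (fun x z y => f x y z) k₁ k₃ k₂ (r, t, s) = truncBox f k₁ k₂ k₃ (r, s, t) := by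
  have hcont := h.continuous_mixedDeriv_fst (Nat.zero_le 3)
  simp only [truncBox, ← mixedDeriv_zero f, intervalIntegral.integral_mul_const]
  exact intervalIntegral_mul_e_swap
    (g := fun y z => ∫ x in -r..r, mixedDeriv f 0 0 0 (x, y, z) * e k₁ x) (by fun_prop) ..

lemma norm_integral_mixedDeriv_boundary_le (h : DecayingPartials K f) (hk₂ : k₂ ≠ 0) {i : ℕ}
    (hi : i < 3) (s x z : ℝ) :
    ‖∫ y in -s..s, mixedDeriv f i 0 0 (x, y, z) * e k₂ y‖ ≤
      oscConst k₂ (weight (2 / 3)) * (K * weight (1 / 6) x) := by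
  have hcont : Continuous (mixedDeriv f i 1 0) := h.continuous_mixedDeriv (by omega)
  refine norm_integral_mul_e_le hk₂ (fun y => h.hasDerivAt_snd (by omega) x y z) (by fun_prop)
    (integrable_weight (by norm_num)) (fun y => ?_) (fun y => ?_) (-s) s
  · simpa using h.norm_mixedDeriv_boundary_le hi zero_le_one zero_le_one x y z
  · simpa using h.norm_mixedDeriv_boundary_le hi le_rfl zero_le_one x y z

lemma norm_integral_integral_mixedDeriv_boundary_le (h : DecayingPartials K f) (hk₂ : k₂ ≠ 0)
    (hk₃ : k₃ ≠ 0) {i : ℕ} (hi : i < 3) (s t x : ℝ) :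
    ‖∫ z in -t..t, (∫ y in -s..s, mixedDeriv f i 0 0 (x, y, z) * e k₂ y) * e k₃ z‖ ≤
      oscConst k₃ (weight (2 / 3)) * (oscConst k₂ (weight (2 / 3)) * (K * weight (1 / 6) x)) := by
  have hcont : ∀ j ≤ 1, ∀ k ≤ 1, Continuous (mixedDeriv f i j k) := fun j hj k hk =>
    h.continuous_mixedDeriv (by omega)
  have h00 := hcont 0 zero_le_one 0 zero_le_one
  have h01 := hcont 0 zero_le_one 1 le_rfl
  have h10 := hcont 1 le_rfl 0 zero_le_one
  have h11 := hcont 1 le_rfl 1 le_rfl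
  have hint : Integrable (weight (2 / 3)) := integrable_weight (by norm_num)
  refine norm_integral_integral_mul_e_le hk₃ hk₂
    (g := fun z y => mixedDeriv f i 0 0 (x, y, z)) (gx := fun z y => mixedDeriv f i 0 1 (x, y, z))
    (gy := fun z y => mixedDeriv f i 1 0 (x, y, z)) (gxy := fun z y => mixedDeriv f i 1 1 (x, y, z))
    (by fun_prop) (by fun_prop) (by fun_prop) (by fun_prop)
    (fun z y => h.hasDerivAt_thd (by omega) x y z) (fun z y => h.hasDerivAt_snd (by omega) x y z)
    (fun z y => h.hasDerivAt_snd (by omega) x y z) hint hint (fun z y => ?_) (fun z y => ?_)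
    (fun z y => ?_) (fun z y => ?_) (-t) t (-s) s
  · simpa using h.norm_mixedDeriv_boundary_le hi zero_le_one zero_le_one x y z
  · simpa using h.norm_mixedDeriv_boundary_le hi zero_le_one le_rfl x y z
  · simpa using h.norm_mixedDeriv_boundary_le hi le_rfl zero_le_one x y z
  · simpa [mul_assoc, mul_comm, mul_left_comm] using
      h.norm_mixedDeriv_boundary_le hi le_rfl le_rfl x y z

lemma tendsto_truncA_integral (h : DecayingPartials K f) (hk₁ : k₁ ≠ 0) (y z : ℝ) :
    Tendsto (truncA f k₁ y z) atTop
      (𝓝 ((Complex.I * k₁)⁻¹ ^ 3 * ∫ x, mixedDeriv f 3 0 0 (x, y, z) * e k₁ x)) := by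
  have hvanish := tendsto_const_mul_weight_cocompact K (by norm_num : (0 : ℝ) < 1 / 6)
  have hlim := tendsto_integral_mul_e_of_iterated_parts hk₁
    (g := fun i _ x => mixedDeriv f i 0 0 (x, y, z))
    (fun i hi _ => (h.continuous_mixedDeriv_fst hi).comp (by fun_prop))
    (fun i hi _ x => h.hasDerivAt_fst (by omega) x y z) hvanish
    (fun i hi _ x => by simpa using h.norm_mixedDeriv_boundary_le hi zero_le_one zero_le_one x y z)
    (((integrable_weight (by norm_num)).mul_const _).const_mul K)
    (fun _ x => h.norm_mixedDeriv_three_le x y z) (fun x => tendsto_const_nhds) tendsto_id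
  exact hlim.congr fun r => by simp only [truncA, mixedDeriv_zero, id]

lemma A_eq (h : DecayingPartials K f) (hk₁ : k₁ ≠ 0) (y z : ℝ) :
    A f k₁ y z = (Complex.I * k₁)⁻¹ ^ 3 * ∫ x, mixedDeriv f 3 0 0 (x, y, z) * e k₁ x :=
  (h.tendsto_truncA_integral hk₁ y z).limUnder_eq

lemma tendsto_truncA (h : DecayingPartials K f) (hk₁ : k₁ ≠ 0) (y z : ℝ) :
    Tendsto (truncA f k₁ y z) atTop (𝓝 (A f k₁ y z)) := by
  rw [h.A_eq hk₁]
  exact h.tendsto_truncA_integral hk₁ y z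

lemma norm_integral_mixedDeriv_three_le (h : DecayingPartials K f) (k₂ s x z : ℝ) :
    ‖∫ y in -s..s, mixedDeriv f 3 0 0 (x, y, z) * e k₂ y‖ ≤
      K * (weight (2 / 3) x * ((∫ y, weight (2 / 3) y) * weight (2 / 3) z)) := by
  simp only [← integral_mul_const, ← integral_const_mul]
  exact norm_intervalIntegral_le_integral
    ((((integrable_weight (by norm_num)).mul_const _).const_mul _).const_mul K)
    (fun y => (norm_mul_e _ k₂ y).trans_le (h.norm_mixedDeriv_three_le x y z)) (-s) s

lemma norm_integral_integral_mixedDeriv_three_le (h : DecayingPartials K f) (k₂ k₃ s t x : ℝ) :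
    ‖∫ z in -t..t, (∫ y in -s..s, mixedDeriv f 3 0 0 (x, y, z) * e k₂ y) * e k₃ z‖ ≤
      K * (weight (2 / 3) x * ((∫ y, weight (2 / 3) y) * ∫ z, weight (2 / 3) z)) := by
  simp only [← integral_const_mul (μ := volume) (_ : ℝ) fun z => weight (2 / 3) z]
  simp only [← integral_const_mul]
  exact norm_intervalIntegral_le_integral
    ((((integrable_weight (by norm_num)).const_mul _).const_mul _).const_mul K)
    (fun z => (norm_mul_e _ k₃ z).trans_le (h.norm_integral_mixedDeriv_three_le k₂ s x z)) (-t) t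

lemma tendsto_integral_mixedDeriv_three (h : DecayingPartials K f) {ι : Type*} {L : Filter ι}
    [L.IsCountablyGenerated] {s : ι → ℝ} (hs : Tendsto s L atTop) (k₂ x z : ℝ) :
    Tendsto (fun i => ∫ y in -s i..s i, mixedDeriv f 3 0 0 (x, y, z) * e k₂ y) L
      (𝓝 (∫ y, mixedDeriv f 3 0 0 (x, y, z) * e k₂ y)) := by
  have hcont := h.continuous_mixedDeriv_fst le_rfl
  exact tendsto_intervalIntegral_of_dominated
    (fun _ => Continuous.aestronglyMeasurable (by fun_prop))
    ((((integrable_weight (by norm_num)).mul_const _).const_mul _).const_mul K)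
    (fun _ y => (norm_mul_e _ k₂ y).trans_le (h.norm_mixedDeriv_three_le x y z)) hs
    (fun y => tendsto_const_nhds)

lemma tendsto_integral_integral_mixedDeriv_three (h : DecayingPartials K f) {ι : Type*}
    {L : Filter ι} [L.IsCountablyGenerated] {s t : ι → ℝ} (hs : Tendsto s L atTop)
    (ht : Tendsto t L atTop) (k₂ k₃ x : ℝ) :
    Tendsto (fun i => ∫ z in -t i..t i,
        (∫ y in -s i..s i, mixedDeriv f 3 0 0 (x, y, z) * e k₂ y) * e k₃ z) L
      (𝓝 (∫ z, (∫ y, mixedDeriv f 3 0 0 (x, y, z) * e k₂ y) * e k₃ z)) := by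
  have hcont := h.continuous_mixedDeriv_fst le_rfl
  exact tendsto_intervalIntegral_of_dominated
    (fun _ => Continuous.aestronglyMeasurable (by fun_prop))
    ((((integrable_weight (by norm_num)).const_mul _).const_mul _).const_mul K)
    (fun i z => (norm_mul_e _ k₃ z).trans_le (h.norm_integral_mixedDeriv_three_le k₂ (s i) x z)) ht
    (fun z => (h.tendsto_integral_mixedDeriv_three hs k₂ x z).mul_const _)

lemma tendsto_truncF_integral (h : DecayingPartials K f) (hk₁ : k₁ ≠ 0) (hk₂ : k₂ ≠ 0) (z : ℝ) :
    Tendsto (truncF f k₁ k₂ z) atTop (𝓝 ((Complex.I * k₁)⁻¹ ^ 3 *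
      ∫ x, (∫ y, mixedDeriv f 3 0 0 (x, y, z) * e k₂ y) * e k₁ x)) := by
  have hcont {i : ℕ} (hi : i ≤ 3) := h.continuous_mixedDeriv_fst hi
  have hvanish := tendsto_const_mul_weight_cocompact K (by norm_num : (0 : ℝ) < 1 / 6)
  have hlim := tendsto_integral_mul_e_of_iterated_parts hk₁
    (g := fun i (p : ℝ × ℝ) x => ∫ y in -p.2..p.2, mixedDeriv f i 0 0 (x, y, z) * e k₂ y)
    (fun i hi p => by have := hcont hi; fun_prop)
    (fun i hi p => hasDerivAt_intervalIntegral_of_continuous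
      (by have := hcont hi.le; fun_prop) (by have := hcont hi; fun_prop)
      (fun x y => (h.hasDerivAt_fst (by omega) x y z).mul_const _) _ _)
    (by simpa using hvanish.const_mul _)
    (fun i hi p x => h.norm_integral_mixedDeriv_boundary_le hk₂ hi p.2 x z)
    (((integrable_weight (by norm_num)).mul_const _).const_mul K)
    (fun p x => h.norm_integral_mixedDeriv_three_le k₂ p.2 x z)
    (fun x => h.tendsto_integral_mixedDeriv_three tendsto_snd_atTop k₂ x z) tendsto_fst_atTop
  exact hlim.congr fun p => (h.truncF_eq k₁ k₂ z p).symm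

lemma tendsto_truncBox_integral (h : DecayingPartials K f) (hk₁ : k₁ ≠ 0) (hk₂ : k₂ ≠ 0)
    (hk₃ : k₃ ≠ 0) :
    Tendsto (truncBox f k₁ k₂ k₃) atTop (𝓝 ((Complex.I * k₁)⁻¹ ^ 3 *
      ∫ x, (∫ z, (∫ y, mixedDeriv f 3 0 0 (x, y, z) * e k₂ y) * e k₃ z) * e k₁ x)) := by
  have hcont {i : ℕ} (hi : i ≤ 3) := h.continuous_mixedDeriv_fst hi
  have hderiv : ∀ i < 3, ∀ s z x, HasDerivAt
      (fun x => ∫ y in -s..s, mixedDeriv f i 0 0 (x, y, z) * e k₂ y)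
      (∫ y in -s..s, mixedDeriv f (i + 1) 0 0 (x, y, z) * e k₂ y) x := fun i hi s z =>
    hasDerivAt_intervalIntegral_of_continuous
      (by have := hcont hi.le; fun_prop) (by have := hcont hi; fun_prop)
      (fun x y => (h.hasDerivAt_fst (by omega) x y z).mul_const _) _ _
  have hvanish := tendsto_const_mul_weight_cocompact K (by norm_num : (0 : ℝ) < 1 / 6)
  have hlim := tendsto_integral_mul_e_of_iterated_parts hk₁
    (g := fun i (p : ℝ × ℝ × ℝ) x => ∫ z in -p.2.2..p.2.2,
      (∫ y in -p.2.1..p.2.1, mixedDeriv f i 0 0 (x, y, z) * e k₂ y) * e k₃ z)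
    (fun i hi p => by have := hcont hi; fun_prop)
    (fun i hi p => hasDerivAt_intervalIntegral_of_continuous
      (by have := hcont hi.le; fun_prop) (by have := hcont hi; fun_prop)
      (fun x z => (hderiv i hi p.2.1 z x).mul_const _) _ _)
    (by simpa using (hvanish.const_mul _).const_mul _)
    (fun i hi p x => h.norm_integral_integral_mixedDeriv_boundary_le hk₂ hk₃ hi p.2.1 p.2.2 x)
    (((integrable_weight (by norm_num)).mul_const _).const_mul K)
    (fun p x => h.norm_integral_integral_mixedDeriv_three_le k₂ k₃ p.2.1 p.2.2 x)
    (fun x => h.tendsto_integral_integral_mixedDeriv_three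
      (tendsto_fst_atTop.comp tendsto_snd_atTop) (tendsto_snd_atTop.comp tendsto_snd_atTop)
      k₂ k₃ x) tendsto_fst_atTop
  exact hlim.congr fun p => (h.truncBox_eq k₁ k₂ k₃ p).symm

lemma integrable_mixedDeriv_three (h : DecayingPartials K f) : Integrable (mixedDeriv f 3 0 0) :=
  have hweight : Integrable (weight (2 / 3)) := integrable_weight (by norm_num)
  integrable_of_norm_le_mul_mul (h.continuous_mixedDeriv_fst le_rfl) hweight hweight hweight
    h.norm_mixedDeriv_three_le

lemma integrable_mixedDeriv_three_slice (h : DecayingPartials K f) (z : ℝ) :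
    Integrable fun p : ℝ × ℝ => mixedDeriv f 3 0 0 (p.1, p.2, z) := by
  have hcont := h.continuous_mixedDeriv_fst le_rfl
  have hweight : Integrable (weight (2 / 3)) := integrable_weight (by norm_num)
  exact ((hweight.mul_prod (hweight.mul_const (weight (2 / 3) z))).const_mul K).mono'
    (Continuous.aestronglyMeasurable (by fun_prop))
    (.of_forall fun p => h.norm_mixedDeriv_three_le p.1 p.2 z)

lemma integrable_integral_mixedDeriv_three (h : DecayingPartials K f) (k₂ : ℝ) :
    Integrable fun p : ℝ × ℝ => ∫ y, mixedDeriv f 3 0 0 (p.1, y, p.2) * e k₂ y := by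
  have hcont := h.continuous_mixedDeriv_fst le_rfl
  have hweight : Integrable (weight (2 / 3)) := integrable_weight (by norm_num)
  have hint : Integrable fun p : ℝ × ℝ × ℝ => mixedDeriv f 3 0 0 (p.2.1, p.1, p.2.2) :=
    integrable_of_norm_le_mul_mul (by fun_prop) hweight hweight hweight
      fun y x z => (h.norm_mixedDeriv_three_le x y z).trans_eq (by ring)
  exact (integrable_mul_e hint measurable_fst k₂).integral_prod_right

lemma integrable_A (h : DecayingPartials K f) (hk₁ : k₁ ≠ 0) :
    Integrable fun p : ℝ × ℝ => A f k₁ p.1 p.2 := by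
  simp only [h.A_eq hk₁]
  exact (integrable_mul_e h.integrable_mixedDeriv_three measurable_fst k₁).integral_prod_right
    |>.const_mul _

lemma integrable_A_slice (h : DecayingPartials K f) (hk₁ : k₁ ≠ 0) (z : ℝ) :
    Integrable fun y => A f k₁ y z := by
  simp only [h.A_eq hk₁]
  exact (integrable_mul_e (h.integrable_mixedDeriv_three_slice z) measurable_fst
    k₁).integral_prod_right.const_mul _

lemma F_eq (h : DecayingPartials K f) (hk₁ : k₁ ≠ 0) (hk₂ : k₂ ≠ 0) (z : ℝ) :
    F f k₁ k₂ z = (Complex.I * k₁)⁻¹ ^ 3 *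
      ∫ x, (∫ y, mixedDeriv f 3 0 0 (x, y, z) * e k₂ y) * e k₁ x :=
  (h.tendsto_truncF_integral hk₁ hk₂ z).limUnder_eq

lemma tendsto_truncF (h : DecayingPartials K f) (hk₁ : k₁ ≠ 0) (hk₂ : k₂ ≠ 0) (z : ℝ) :
    Tendsto (truncF f k₁ k₂ z) atTop (𝓝 (F f k₁ k₂ z)) := by
  rw [h.F_eq hk₁ hk₂]
  exact h.tendsto_truncF_integral hk₁ hk₂ z

lemma F_eq_integral_A (h : DecayingPartials K f) (hk₁ : k₁ ≠ 0) (hk₂ : k₂ ≠ 0) (z : ℝ) :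
    F f k₁ k₂ z = ∫ y, A f k₁ y z * e k₂ y := by
  simp only [h.F_eq hk₁ hk₂, h.A_eq hk₁, mul_assoc, integral_const_mul]
  congr 1
  exact integral_mul_e_swap (h.integrable_mixedDeriv_three_slice z) k₁ k₂

lemma integrable_F (h : DecayingPartials K f) (hk₁ : k₁ ≠ 0) (hk₂ : k₂ ≠ 0) :
    Integrable (F f k₁ k₂) := by
  simp only [funext (h.F_eq_integral_A hk₁ hk₂)]
  exact (integrable_mul_e (h.integrable_A hk₁) measurable_fst k₂).integral_prod_right

lemma hatF_eq_hatA (h : DecayingPartials K f) (hk₁ : k₁ ≠ 0) (hk₂ : k₂ ≠ 0) (k₃ : ℝ) :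
    hatF f k₁ k₂ k₃ = hatA f k₁ k₂ k₃ := by
  simp only [hatF, hatA_eq_integral, h.F_eq_integral_A hk₁ hk₂]

lemma tendsto_truncBox (h : DecayingPartials K f) (hk₁ : k₁ ≠ 0) (hk₂ : k₂ ≠ 0) (hk₃ : k₃ ≠ 0) :
    Tendsto (truncBox f k₁ k₂ k₃) atTop (𝓝 (hatA f k₁ k₂ k₃)) := by
  have hhat : hatA f k₁ k₂ k₃ = (Complex.I * k₁)⁻¹ ^ 3 *
      ∫ x, (∫ z, (∫ y, mixedDeriv f 3 0 0 (x, y, z) * e k₂ y) * e k₃ z) * e k₁ x := by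
    rw [integral_mul_e_swap (h.integrable_integral_mixedDeriv_three k₂)]
    simp only [← h.hatF_eq_hatA hk₁ hk₂, hatF, h.F_eq hk₁ hk₂, mul_assoc, integral_const_mul]
  rw [hhat]
  exact h.tendsto_truncBox_integral hk₁ hk₂ hk₃

lemma hatA_swap_fst (h : DecayingPartials K f) (hk₁ : k₁ ≠ 0) (hk₂ : k₂ ≠ 0) (hk₃ : k₃ ≠ 0) :
    hatA (fun y x z => f x y z) k₂ k₁ k₃ = hatA f k₁ k₂ k₃ := by
  have hswap : Tendsto (fun p : ℝ × ℝ × ℝ => (p.2.1, p.1, p.2.2)) atTop atTop := by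
    simp only [← prod_atTop_atTop_eq]
    exact (tendsto_fst.comp tendsto_snd).prodMk (tendsto_fst.prodMk (tendsto_snd.comp tendsto_snd))
  have hlim : Tendsto (truncBox f k₁ k₂ k₃) atTop (𝓝 (hatA (fun y x z => f x y z) k₂ k₁ k₃)) :=
    ((h.swap_fst.tendsto_truncBox hk₂ hk₁ hk₃).comp hswap).congr
      fun p => h.truncBox_swap_fst k₁ k₂ k₃ p.1 p.2.1 p.2.2
  exact tendsto_nhds_unique hlim (h.tendsto_truncBox hk₁ hk₂ hk₃)

lemma hatA_swap_snd (h : DecayingPartials K f) (hk₁ : k₁ ≠ 0) (hk₂ : k₂ ≠ 0) (hk₃ : k₃ ≠ 0) :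
    hatA (fun x z y => f x y z) k₁ k₃ k₂ = hatA f k₁ k₂ k₃ := by
  have hswap : Tendsto (fun p : ℝ × ℝ × ℝ => (p.1, p.2.2, p.2.1)) atTop atTop := by
    simp only [← prod_atTop_atTop_eq]
    exact tendsto_fst.prodMk ((tendsto_snd.comp tendsto_snd).prodMk (tendsto_fst.comp tendsto_snd))
  have hlim : Tendsto (truncBox f k₁ k₂ k₃) atTop (𝓝 (hatA (fun x z y => f x y z) k₁ k₃ k₂)) :=
    ((h.swap_snd.tendsto_truncBox hk₁ hk₃ hk₂).comp hswap).congr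
      fun p => h.truncBox_swap_snd k₁ k₂ k₃ p.1 p.2.1 p.2.2
  exact tendsto_nhds_unique hlim (h.tendsto_truncBox hk₁ hk₂ hk₃)

-- `B` and `C` unfold to `A`, and `G` and `H` to `F`, for `f` with its variables permuted.
lemma partialTransformsExist (h : DecayingPartials K f) (hk₁ : k₁ ≠ 0) (hk₂ : k₂ ≠ 0)
    (hk₃ : k₃ ≠ 0) : PartialTransformsExist f k₁ k₂ k₃ where
  exists_A := h.tendsto_truncA hk₁
  exists_B := h.swap_fst.tendsto_truncA hk₂
  exists_C := h.swap_snd.swap_fst.tendsto_truncA hk₃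
  exists_F := h.tendsto_truncF hk₁ hk₂
  exists_G := h.swap_snd.tendsto_truncF hk₁ hk₃
  exists_H := h.swap_fst.swap_snd.tendsto_truncF hk₂ hk₃

lemma integrable_A_mul_e_mul_e (h : DecayingPartials K f) (hk₁ : k₁ ≠ 0) (k₂ k₃ : ℝ) :
    Integrable fun p : ℝ × ℝ => A f k₁ p.1 p.2 * e k₂ p.1 * e k₃ p.2 :=
  integrable_mul_e (integrable_mul_e (h.integrable_A hk₁) measurable_fst k₂) measurable_snd k₃

lemma integrable_A_slice_mul_e_mul_e (h : DecayingPartials K f) (hk₁ : k₁ ≠ 0) (k₂ k₃ z : ℝ) :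
    Integrable fun y => A f k₁ y z * e k₂ y * e k₃ z :=
  (integrable_mul_e (h.integrable_A_slice hk₁ z) measurable_id k₂).mul_const _

lemma integrable_F_mul_e (h : DecayingPartials K f) (hk₁ : k₁ ≠ 0) (hk₂ : k₂ ≠ 0) (k₃ : ℝ) :
    Integrable fun z => F f k₁ k₂ z * e k₃ z :=
  integrable_mul_e (h.integrable_F hk₁ hk₂) measurable_id k₃

lemma fullTransformsDefined (h : DecayingPartials K f) (hk₁ : k₁ ≠ 0) (hk₂ : k₂ ≠ 0)
    (hk₃ : k₃ ≠ 0) : FullTransformsDefined f k₁ k₂ k₃ where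
  integrable_A := h.integrable_A_mul_e_mul_e hk₁ k₂ k₃
  integrable_A_inner := h.integrable_A_slice_mul_e_mul_e hk₁ k₂ k₃
  integrable_B := h.swap_fst.integrable_A_mul_e_mul_e hk₂ k₁ k₃
  integrable_B_inner := h.swap_fst.integrable_A_slice_mul_e_mul_e hk₂ k₁ k₃
  integrable_C := h.swap_snd.swap_fst.integrable_A_mul_e_mul_e hk₃ k₁ k₂
  integrable_C_inner := h.swap_snd.swap_fst.integrable_A_slice_mul_e_mul_e hk₃ k₁ k₂
  integrable_F := h.integrable_F_mul_e hk₁ hk₂ k₃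
  integrable_G := h.swap_snd.integrable_F_mul_e hk₁ hk₃ k₂
  integrable_H := h.swap_fst.swap_snd.integrable_F_mul_e hk₂ hk₃ k₁

lemma hatB_eq_hatA (h : DecayingPartials K f) (hk₁ : k₁ ≠ 0) (hk₂ : k₂ ≠ 0) (hk₃ : k₃ ≠ 0) :
    hatB f k₁ k₂ k₃ = hatA f k₁ k₂ k₃ :=
  h.hatA_swap_fst hk₁ hk₂ hk₃

lemma hatC_eq_hatA (h : DecayingPartials K f) (hk₁ : k₁ ≠ 0) (hk₂ : k₂ ≠ 0) (hk₃ : k₃ ≠ 0) :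
    hatC f k₁ k₂ k₃ = hatA f k₁ k₂ k₃ :=
  (h.swap_snd.hatA_swap_fst hk₁ hk₃ hk₂).trans (h.hatA_swap_snd hk₁ hk₂ hk₃)

lemma hatG_eq_hatA (h : DecayingPartials K f) (hk₁ : k₁ ≠ 0) (hk₂ : k₂ ≠ 0) (hk₃ : k₃ ≠ 0) :
    hatG f k₁ k₂ k₃ = hatA f k₁ k₂ k₃ :=
  (h.swap_snd.hatF_eq_hatA hk₁ hk₃ k₂).trans (h.hatA_swap_snd hk₁ hk₂ hk₃)

lemma hatH_eq_hatA (h : DecayingPartials K f) (hk₁ : k₁ ≠ 0) (hk₂ : k₂ ≠ 0) (hk₃ : k₃ ≠ 0) :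
    hatH f k₁ k₂ k₃ = hatA f k₁ k₂ k₃ :=
  calc hatH f k₁ k₂ k₃
    _ = hatA (fun y z x => f x y z) k₂ k₃ k₁ := h.swap_fst.swap_snd.hatF_eq_hatA hk₂ hk₃ k₁
    _ = hatA (fun y x z => f x y z) k₂ k₁ k₃ := h.swap_fst.hatA_swap_snd hk₂ hk₁ hk₃
    _ = hatA f k₁ k₂ k₃ := h.hatA_swap_fst hk₁ hk₂ hk₃

end DecayingPartials

end Transforms

end

end NormalFourier

open NormalFourier in
theorem lemma5p3_general (f : ℝ → ℝ → ℝ → ℝ)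
    (hf : ContDiff ℝ 4 (fun p : ℝ × ℝ × ℝ => f p.1 p.2.1 p.2.2))
    (hdecrease : ∀ i j k : ℕ, i + j + k ≤ 4 → Decrease₃ (i + j + k + 1) (partialDeriv i j k f))
    (k₁ k₂ k₃ : ℝ) (hk₁ : k₁ ≠ 0) (hk₂ : k₂ ≠ 0) (hk₃ : k₃ ≠ 0) :
    PartialTransformsExist f k₁ k₂ k₃ ∧
    FullTransformsDefined f k₁ k₂ k₃ ∧
    hatA f k₁ k₂ k₃ = hatB f k₁ k₂ k₃ ∧
    hatB f k₁ k₂ k₃ = hatC f k₁ k₂ k₃ ∧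
    hatC f k₁ k₂ k₃ = hatF f k₁ k₂ k₃ ∧
    hatF f k₁ k₂ k₃ = hatG f k₁ k₂ k₃ ∧
    hatG f k₁ k₂ k₃ = hatH f k₁ k₂ k₃ ∧
    Tendsto (truncBox f k₁ k₂ k₃) atTop (𝓝 (hatA f k₁ k₂ k₃)) := by
  obtain ⟨K, h⟩ := exists_decayingPartials hf hdecrease
  rw [h.hatB_eq_hatA hk₁ hk₂ hk₃, h.hatC_eq_hatA hk₁ hk₂ hk₃, h.hatF_eq_hatA hk₁ hk₂,
    h.hatG_eq_hatA hk₁ hk₂ hk₃, h.hatH_eq_hatA hk₁ hk₂ hk₃]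
  exact ⟨h.partialTransformsExist hk₁ hk₂ hk₃, h.fullTransformsDefined hk₁ hk₂ hk₃, rfl, rfl, rfl,
    rfl, rfl, h.tendsto_truncBox hk₁ hk₂ hk₃⟩

theorem lemma5p3 (f : ℝ → ℝ → ℝ → ℝ) (hf : NormalFourier.Normal₃ f)
    (k₁ k₂ k₃ : ℝ) (hk₁ : k₁ ≠ 0) (hk₂ : k₂ ≠ 0) (hk₃ : k₃ ≠ 0) :
    NormalFourier.PartialTransformsExist f k₁ k₂ k₃ ∧
    NormalFourier.FullTransformsDefined f k₁ k₂ k₃ ∧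
    NormalFourier.hatA f k₁ k₂ k₃ = NormalFourier.hatB f k₁ k₂ k₃ ∧
    NormalFourier.hatB f k₁ k₂ k₃ = NormalFourier.hatC f k₁ k₂ k₃ ∧
    NormalFourier.hatC f k₁ k₂ k₃ = NormalFourier.hatF f k₁ k₂ k₃ ∧
    NormalFourier.hatF f k₁ k₂ k₃ = NormalFourier.hatG f k₁ k₂ k₃ ∧
    NormalFourier.hatG f k₁ k₂ k₃ = NormalFourier.hatH f k₁ k₂ k₃ ∧
    Tendsto (NormalFourier.truncBox f k₁ k₂ k₃) atTop (𝓝 (NormalFourier.hatA f k₁ k₂ k₃)) := by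
  exact lemma5p3_general f (contDiff_infty.1 hf.smooth 4)
    (fun i j k _ => hf.decrease_partialDeriv i j k) k₁ k₂ k₃ hk₁ hk₂ hk₃
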